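/- For a bounded self-adjoint operator $A$ on a complex Hilbert space, let $N_-(A)\in\{0,1,2,\dots\}\cup\{\infty\}$ denote the total multiplicity of its strictly negative spectrum, that is, the dimension of the range of the spectral projection $E_A((-\infty,0))$. A bounded operator $H$ on the complex space $L^2(\mathbb R_+)$, $\mathbb R_+=(0,\infty)$, is called a Hankel operator with kernel $h\in L^1_{\mathrm{loc}}(\mathbb R_+)$ if $$(Hf)(t)=\int_0^\infty h(t+s)f(s)\,ds$$ for almost all $t>0$ and every continuous $f$ with compact support in $\mathbb R_+$. **Theorem.** Let $H_0$ be the Carleman operator on $L^2(\mathbb R_+)$, that is, the (bounded, self-adjoint) Hankel operator with kernel $h_0(t)=t^{-1}$. Let $V$ be a self-adjoint Hankel operator of finite rank on $L^2(\mathbb R_+)$, and let $H=H_0+V$. Then $$N_-(H)=N_-(V).$$ In particular, $H\ge 0$ if and only if $V\ge 0$. -/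

import Mathlib

open MeasureTheory Set Filter
open scoped ENNReal

noncomputable section

namespace FiniteRankHankel

/-- Lebesgue measure on the half-line `ℝ₊ = (0, ∞)`. -/
abbrev halfLine : Measure ℝ := volume.restrict (Ioi 0)

/-- The complex Hilbert space `L²(ℝ₊)`. -/
abbrev L2Pos : Type := Lp ℂ 2 halfLine

/-- The bounded operator `H` on `L²(ℝ₊)` is the Hankel operator with kernel `h`, i.e. the integral
operator `(H f)(t) = ∫₀^∞ h(t + s) f(s) ds`. The kernel is a locally integrable function on
`(0, ∞)`, and the formula is required on the dense set of continuous functions `f` with compact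
support in `(0, ∞)`, for which the integral converges absolutely for every `t > 0`. -/
def HasHankelKernel (H : L2Pos →L[ℂ] L2Pos) (h : ℝ → ℂ) : Prop :=
  LocallyIntegrableOn h (Ioi 0) ∧
    ∀ φ : ℝ → ℂ, Continuous φ → HasCompactSupport φ → tsupport φ ⊆ Ioi 0 →
      ∀ f : L2Pos, f =ᵐ[halfLine] φ →
        H f =ᵐ[halfLine] fun t => ∫ s in Ioi (0 : ℝ), h (t + s) * φ s

/-- A (bounded) Hankel operator on `L²(ℝ₊)`. -/
def IsHankel (H : L2Pos →L[ℂ] L2Pos) : Prop :=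
  ∃ h : ℝ → ℂ, HasHankelKernel H h

/-- An operator of finite rank. -/
def HasFiniteRank (H : L2Pos →L[ℂ] L2Pos) : Prop :=
  FiniteDimensional ℂ (LinearMap.range (H : L2Pos →ₗ[ℂ] L2Pos))

section Multiplicity

variable {E : Type*} [NormedAddCommGroup E] [InnerProductSpace ℂ E] [CompleteSpace E]

/-- The spectral subspace of a bounded self-adjoint operator `A` for the half-line `(-∞, 0)`, i.e.
the range of the spectral projection `E_A((-∞, 0))`. The negative part is given by the functional
calculus, `A⁻ = ∫_{(-∞, 0)} |λ| dE_A(λ)`, and the closure of its range is exactly the range of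
`E_A((-∞, 0))`. -/
def negativeSpectralSubspace (A : E →L[ℂ] E) : Submodule ℂ E :=
  (LinearMap.range ((A⁻ : E →L[ℂ] E) : E →ₗ[ℂ] E)).topologicalClosure

/-- `N₋(A)`: the total multiplicity of the strictly negative spectrum of a bounded self-adjoint
operator `A`, a natural number or `∞`. -/
def negativeMultiplicity (A : E →L[ℂ] E) : ℕ∞ :=
  Cardinal.toENat (Module.rank ℂ (negativeSpectralSubspace A))

end Multiplicity

/-! ### The Carleman operator -/

lemma lintegral_rpow_bound {t : ℝ} (ht : 0 < t) :
    ∫⁻ s in Ioi (0 : ℝ), ENNReal.ofReal ((t + s)⁻¹ * s ^ (-(1 / 2) : ℝ)) ≤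
      ENNReal.ofReal (4 * t ^ (-(1 / 2) : ℝ)) := by
  have hsplit : Ioi (0 : ℝ) = Ioc 0 t ∪ Ioi t := (Ioc_union_Ioi_eq_Ioi ht.le).symm
  have h1 : ∫⁻ s in Ioc (0 : ℝ) t, ENNReal.ofReal ((t + s)⁻¹ * s ^ (-(1 / 2) : ℝ)) ≤
      ENNReal.ofReal (2 * t ^ (-(1 / 2) : ℝ)) := by
    have hi : IntervalIntegrable (fun s : ℝ => t⁻¹ * s ^ (-(1 / 2) : ℝ)) volume 0 t :=
      (intervalIntegral.intervalIntegrable_rpow' (by norm_num)).const_mul _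
    have hi' := (intervalIntegrable_iff_integrableOn_Ioc_of_le ht.le).1 hi
    calc _ ≤ ∫⁻ s in Ioc (0 : ℝ) t, ENNReal.ofReal (t⁻¹ * s ^ (-(1 / 2) : ℝ)) := by
          refine setLIntegral_mono' measurableSet_Ioc fun s hs => ENNReal.ofReal_le_ofReal ?_
          have : (t + s)⁻¹ ≤ t⁻¹ := inv_anti₀ ht (by linarith [hs.1])
          exact mul_le_mul_of_nonneg_right this (Real.rpow_nonneg hs.1.le _)
      _ = ENNReal.ofReal (∫ s in Ioc (0 : ℝ) t, t⁻¹ * s ^ (-(1 / 2) : ℝ)) := by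
          rw [ofReal_integral_eq_lintegral_ofReal hi']
          refine (ae_restrict_iff' measurableSet_Ioc).2 (Eventually.of_forall fun s hs => ?_)
          exact mul_nonneg (inv_nonneg.2 ht.le) (Real.rpow_nonneg hs.1.le _)
      _ ≤ _ := by
          refine ENNReal.ofReal_le_ofReal (le_of_eq ?_)
          rw [← intervalIntegral.integral_of_le ht.le, intervalIntegral.integral_const_mul,
            integral_rpow (Or.inl (by norm_num)), Real.zero_rpow (by norm_num)]
          have : t ^ (-(1 / 2) : ℝ) = t⁻¹ * t ^ (-(1 / 2) + 1 : ℝ) := by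
            rw [Real.rpow_add ht, Real.rpow_one]; field_simp
          rw [this]; ring
  have h2 : ∫⁻ s in Ioi t, ENNReal.ofReal ((t + s)⁻¹ * s ^ (-(1 / 2) : ℝ)) ≤
      ENNReal.ofReal (2 * t ^ (-(1 / 2) : ℝ)) := by
    have hi' := integrableOn_Ioi_rpow_of_lt (a := (-(3 / 2) : ℝ)) (by norm_num) ht
    calc _ ≤ ∫⁻ s in Ioi t, ENNReal.ofReal (s ^ (-(3 / 2) : ℝ)) := by
          refine setLIntegral_mono' measurableSet_Ioi fun s hs => ENNReal.ofReal_le_ofReal ?_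
          have hs0 : 0 < s := ht.trans hs
          have h3 : (t + s)⁻¹ ≤ s⁻¹ := inv_anti₀ hs0 (by linarith)
          have h4 : s ^ (-(3 / 2) : ℝ) = s⁻¹ * s ^ (-(1 / 2) : ℝ) := by
            rw [← Real.rpow_neg_one, ← Real.rpow_add hs0]; norm_num
          rw [h4]
          exact mul_le_mul_of_nonneg_right h3 (Real.rpow_nonneg hs0.le _)
      _ = ENNReal.ofReal (∫ s in Ioi t, s ^ (-(3 / 2) : ℝ)) := by
          rw [ofReal_integral_eq_lintegral_ofReal hi']
          refine (ae_restrict_iff' measurableSet_Ioi).2 (Eventually.of_forall fun s hs => ?_)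
          exact Real.rpow_nonneg (ht.trans hs).le _
      _ ≤ _ := by
          refine ENNReal.ofReal_le_ofReal (le_of_eq ?_)
          rw [integral_Ioi_rpow_of_lt (by norm_num) ht]
          norm_num; ring
  rw [hsplit]
  refine (lintegral_union_le _ _ _).trans ((add_le_add h1 h2).trans (le_of_eq ?_))
  have := Real.rpow_nonneg ht.le (-(1 / 2) : ℝ)
  rw [← ENNReal.ofReal_add (by positivity) (by positivity)]
  congr 1; ring

lemma schur_pointwise {F : ℝ → ℝ≥0∞} (hF : AEMeasurable F halfLine) {t : ℝ} (ht : 0 < t) :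
    (∫⁻ s in Ioi (0 : ℝ), ENNReal.ofReal (t + s)⁻¹ * F s) ^ 2 ≤
      ∫⁻ s in Ioi (0 : ℝ), ENNReal.ofReal (4 * t ^ (-(1 / 2) : ℝ) * ((t + s)⁻¹ * s ^ (1 / 2 : ℝ))) *
        F s ^ 2 := by
  set a : ℝ → ℝ≥0∞ := fun s => ENNReal.ofReal (√((t + s)⁻¹ * s ^ (-(1 / 2) : ℝ)))
  set b : ℝ → ℝ≥0∞ := fun s => ENNReal.ofReal (√((t + s)⁻¹ * s ^ (1 / 2 : ℝ))) * F s
  have ha : AEMeasurable a halfLine := by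
    refine Measurable.aemeasurable ?_
    simp only [a]; fun_prop
  have hb : AEMeasurable b halfLine := by
    refine AEMeasurable.mul (Measurable.aemeasurable ?_) hF
    fun_prop
  have hab : ∫⁻ s in Ioi (0 : ℝ), ENNReal.ofReal (t + s)⁻¹ * F s = ∫⁻ s, (a * b) s ∂halfLine := by
    refine setLIntegral_congr_fun measurableSet_Ioi fun s hs => ?_
    have hs : 0 < s := hs
    simp only [Pi.mul_apply, a, b]
    rw [← mul_assoc, ← ENNReal.ofReal_mul (Real.sqrt_nonneg _), ← Real.sqrt_mul (by positivity)]
    congr 2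
    have : (t + s)⁻¹ * s ^ (-(1 / 2) : ℝ) * ((t + s)⁻¹ * s ^ (1 / 2 : ℝ)) = (t + s)⁻¹ ^ 2 := by
      have : s ^ (-(1 / 2) : ℝ) * s ^ (1 / 2 : ℝ) = 1 := by
        rw [← Real.rpow_add hs]; norm_num
      linear_combination (t + s)⁻¹ ^ 2 * this
    rw [this, Real.sqrt_sq (by positivity)]
  have hsq : ∀ x : ℝ≥0∞, (x ^ (1 / 2 : ℝ)) ^ 2 = x := fun x => by
    rw [← ENNReal.rpow_natCast, ← ENNReal.rpow_mul]; norm_num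
  have hcs := ENNReal.lintegral_mul_le_Lp_mul_Lq halfLine Real.HolderConjugate.two_two ha hb
  have hcs2 := pow_le_pow_left' hcs 2
  rw [mul_pow, hsq, hsq] at hcs2
  rw [hab]
  refine hcs2.trans ?_
  have hA : ∫⁻ s, a s ^ (2 : ℝ) ∂halfLine ≤ ENNReal.ofReal (4 * t ^ (-(1 / 2) : ℝ)) := by
    refine le_trans (le_of_eq ?_) (lintegral_rpow_bound ht)
    refine setLIntegral_congr_fun measurableSet_Ioi fun s hs => ?_
    have hs : 0 < s := hs
    simp only [a, ENNReal.rpow_two]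
    rw [← ENNReal.ofReal_pow (Real.sqrt_nonneg _), Real.sq_sqrt (by positivity)]
  refine (mul_le_mul_left hA _).trans ?_
  rw [← lintegral_const_mul' _ _ ENNReal.ofReal_ne_top]
  refine le_of_eq (setLIntegral_congr_fun measurableSet_Ioi fun s hs => ?_)
  have hs : 0 < s := hs
  simp only [b, ENNReal.rpow_two]
  rw [mul_pow, ← ENNReal.ofReal_pow (Real.sqrt_nonneg _), Real.sq_sqrt (by positivity), ← mul_assoc,
    ← ENNReal.ofReal_mul (by positivity)]

/-- The Schur test for the kernel `(t + s)⁻¹`. -/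
lemma schur_bound {F : ℝ → ℝ≥0∞} (hF : AEMeasurable F halfLine) :
    ∫⁻ t in Ioi (0 : ℝ), (∫⁻ s in Ioi (0 : ℝ), ENNReal.ofReal (t + s)⁻¹ * F s) ^ 2 ≤
      16 * ∫⁻ s in Ioi (0 : ℝ), F s ^ 2 := by
  calc _ ≤ ∫⁻ t in Ioi (0 : ℝ), ∫⁻ s in Ioi (0 : ℝ),
        ENNReal.ofReal (4 * t ^ (-(1 / 2) : ℝ) * ((t + s)⁻¹ * s ^ (1 / 2 : ℝ))) * F s ^ 2 :=
        setLIntegral_mono' measurableSet_Ioi fun t ht => schur_pointwise hF ht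
    _ = ∫⁻ s in Ioi (0 : ℝ), ∫⁻ t in Ioi (0 : ℝ),
        ENNReal.ofReal (4 * t ^ (-(1 / 2) : ℝ) * ((t + s)⁻¹ * s ^ (1 / 2 : ℝ))) * F s ^ 2 := by
        refine lintegral_lintegral_swap ?_
        refine AEMeasurable.mul (Measurable.aemeasurable ?_) ((hF.comp_snd).pow_const 2)
        fun_prop
    _ ≤ ∫⁻ s in Ioi (0 : ℝ), 16 * F s ^ 2 := by
        refine setLIntegral_mono' measurableSet_Ioi fun s hs => ?_
        have hs : 0 < s := hs
        rw [lintegral_mul_const _ (by fun_prop)]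
        refine mul_le_mul_left ?_ _
        calc _ = ∫⁻ t in Ioi (0 : ℝ), ENNReal.ofReal (4 * s ^ (1 / 2 : ℝ)) *
              ENNReal.ofReal ((s + t)⁻¹ * t ^ (-(1 / 2) : ℝ)) := by
              refine lintegral_congr fun t => ?_
              rw [← ENNReal.ofReal_mul (by positivity), add_comm s t]
              congr 1; ring
          _ ≤ ENNReal.ofReal (4 * s ^ (1 / 2 : ℝ)) * ENNReal.ofReal (4 * s ^ (-(1 / 2) : ℝ)) := by
              rw [lintegral_const_mul' _ _ ENNReal.ofReal_ne_top]
              exact mul_le_mul_right (lintegral_rpow_bound hs) _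
          _ = 16 := by
              rw [← ENNReal.ofReal_mul (by positivity)]
              have : s ^ (1 / 2 : ℝ) * s ^ (-(1 / 2) : ℝ) = 1 := by
                rw [← Real.rpow_add hs]; norm_num
              have h16 : 4 * s ^ (1 / 2 : ℝ) * (4 * s ^ (-(1 / 2) : ℝ)) = 16 := by
                linear_combination 16 * this
              rw [h16]; norm_num
    _ = _ := lintegral_const_mul' _ _ (by norm_num)

/-- The function `t ↦ ∫₀^∞ (t + s)⁻¹ f(s) ds`. -/
def carlemanFun (f : L2Pos) (t : ℝ) : ℂ := ∫ s in Ioi (0 : ℝ), (((t + s)⁻¹ : ℝ) : ℂ) * f s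

lemma eLpNorm_two_sq (g : ℝ → ℂ) :
    eLpNorm g 2 halfLine ^ 2 = ∫⁻ s in Ioi (0 : ℝ), ‖g s‖ₑ ^ 2 := by
  rw [eLpNorm_eq_lintegral_rpow_enorm_toReal (by norm_num) (by norm_num), ← ENNReal.rpow_natCast,
    ← ENNReal.rpow_mul]
  norm_num

lemma aemeasurable_enorm (f : L2Pos) : AEMeasurable (fun s => ‖f s‖ₑ) halfLine :=
  (Lp.aestronglyMeasurable f).enorm

lemma lintegral_sq_lt_top (f : L2Pos) : ∫⁻ s in Ioi (0 : ℝ), ‖f s‖ₑ ^ 2 < ∞ := by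
  rw [← eLpNorm_two_sq]
  exact ENNReal.pow_lt_top (Lp.eLpNorm_lt_top f)

lemma enorm_kernel_mul (f : L2Pos) {t s : ℝ} (ht : 0 < t) (hs : 0 < s) :
    ‖(((t + s)⁻¹ : ℝ) : ℂ) * f s‖ₑ = ENNReal.ofReal (t + s)⁻¹ * ‖f s‖ₑ := by
  rw [enorm_mul]
  congr 1
  rw [← ofReal_norm, Complex.norm_real, Real.norm_of_nonneg (by positivity)]

lemma aestronglyMeasurable_kernel_mul (f : L2Pos) :
    AEStronglyMeasurable (fun p : ℝ × ℝ => (((p.1 + p.2)⁻¹ : ℝ) : ℂ) * f p.2)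
      (halfLine.prod halfLine) := by
  refine AEStronglyMeasurable.mul (Measurable.aestronglyMeasurable ?_)
    (Lp.aestronglyMeasurable f).comp_snd
  fun_prop

lemma enorm_carlemanFun_le (f : L2Pos) {t : ℝ} (ht : 0 < t) :
    ‖carlemanFun f t‖ₑ ≤ ∫⁻ s in Ioi (0 : ℝ), ENNReal.ofReal (t + s)⁻¹ * ‖f s‖ₑ :=
  (enorm_integral_le_lintegral_enorm _).trans (le_of_eq
    (setLIntegral_congr_fun measurableSet_Ioi fun _ hs => enorm_kernel_mul f ht hs))

lemma eLpNorm_carlemanFun_le (f : L2Pos) :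
    eLpNorm (carlemanFun f) 2 halfLine ≤ 4 * eLpNorm f 2 halfLine := by
  have h : eLpNorm (carlemanFun f) 2 halfLine ^ 2 ≤ (4 * eLpNorm f 2 halfLine) ^ 2 := by
    rw [mul_pow, eLpNorm_two_sq, eLpNorm_two_sq]
    refine (setLIntegral_mono' measurableSet_Ioi fun t ht =>
      pow_le_pow_left' (enorm_carlemanFun_le f ht) 2).trans
      ((schur_bound (aemeasurable_enorm f)).trans (le_of_eq ?_))
    norm_num
  exact (ENNReal.pow_le_pow_left_iff two_ne_zero).1 h

lemma memLp_carlemanFun (f : L2Pos) : MemLp (carlemanFun f) 2 halfLine :=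
  ⟨(aestronglyMeasurable_kernel_mul f).integral_prod_right',
    (eLpNorm_carlemanFun_le f).trans_lt (ENNReal.mul_lt_top (by norm_num) (Lp.eLpNorm_lt_top f))⟩

lemma ae_integrable_kernel_mul (f : L2Pos) :
    ∀ᵐ t ∂halfLine, Integrable (fun s => (((t + s)⁻¹ : ℝ) : ℂ) * f s) halfLine := by
  have hmeas : AEMeasurable
      (fun t => (∫⁻ s in Ioi (0 : ℝ), ENNReal.ofReal (t + s)⁻¹ * ‖f s‖ₑ) ^ 2) halfLine := by
    refine AEMeasurable.pow_const (AEMeasurable.lintegral_prod_right'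
      (f := fun p : ℝ × ℝ => ENNReal.ofReal (p.1 + p.2)⁻¹ * ‖f p.2‖ₑ) ?_) 2
    exact AEMeasurable.mul (Measurable.aemeasurable (by fun_prop)) (aemeasurable_enorm f).comp_snd
  have hfin := ae_lt_top' hmeas ((schur_bound (aemeasurable_enorm f)).trans_lt
    (ENNReal.mul_lt_top (by norm_num) (lintegral_sq_lt_top f))).ne
  filter_upwards [hfin, ae_restrict_mem measurableSet_Ioi] with t ht ht0
  refine ⟨AEStronglyMeasurable.mul (Measurable.aestronglyMeasurable (by fun_prop))
    (Lp.aestronglyMeasurable f), ?_⟩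
  rw [hasFiniteIntegral_iff_enorm,
    setLIntegral_congr_fun measurableSet_Ioi fun s hs => enorm_kernel_mul f ht0 hs]
  by_contra h
  rw [not_lt, top_le_iff] at h
  rw [h] at ht
  simp at ht

/-- The Carleman operator `H₀` on `L²(ℝ₊)`: `(H₀ f)(t) = ∫₀^∞ (t + s)⁻¹ f(s) ds`. -/
def carleman : L2Pos →L[ℂ] L2Pos :=
  LinearMap.mkContinuous
    { toFun := fun f => (memLp_carlemanFun f).toLp (carlemanFun f)
      map_add' := fun f g => by
        rw [← MemLp.toLp_add]
        refine MemLp.toLp_congr _ _ ?_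
        filter_upwards [ae_integrable_kernel_mul f, ae_integrable_kernel_mul g] with t hf hg
        simp only [Pi.add_apply, carlemanFun]
        rw [← integral_add hf hg]
        refine integral_congr_ae ?_
        filter_upwards [Lp.coeFn_add f g] with s hs
        rw [hs, Pi.add_apply, mul_add]
      map_smul' := fun c f => by
        rw [RingHom.id_apply, ← MemLp.toLp_const_smul]
        refine MemLp.toLp_congr _ _ (Eventually.of_forall fun t => ?_)
        simp only [Pi.smul_apply, carlemanFun]
        rw [← integral_smul]
        refine integral_congr_ae ?_
        filter_upwards [Lp.coeFn_smul c f] with s hs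
        rw [hs, Pi.smul_apply, smul_eq_mul, smul_eq_mul]
        ring }
    4
    (fun f => by
      rw [LinearMap.coe_mk, AddHom.coe_mk, Lp.norm_toLp, Lp.norm_def]
      have h := ENNReal.toReal_mono
        (ENNReal.mul_lt_top (by norm_num) (Lp.eLpNorm_lt_top f)).ne (eLpNorm_carlemanFun_le f)
      rw [ENNReal.toReal_mul] at h
      simpa using h)

lemma carleman_apply (f : L2Pos) : carleman f =ᵐ[halfLine] carlemanFun f :=
  MemLp.coeFn_toLp (memLp_carlemanFun f)

/-- The Carleman operator is the Hankel operator with kernel `t⁻¹`. -/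
theorem carleman_hasHankelKernel : HasHankelKernel carleman fun t => ((t⁻¹ : ℝ) : ℂ) := by
  refine ⟨ContinuousOn.locallyIntegrableOn ?_ measurableSet_Ioi, fun φ _ _ _ f hf => ?_⟩
  · exact Complex.continuous_ofReal.comp_continuousOn
      (continuousOn_id.inv₀ fun t ht => (ne_of_gt ht))
  · refine (carleman_apply f).trans (Eventually.of_forall fun t => ?_)
    refine integral_congr_ae ?_
    filter_upwards [hf] with s hs
    rw [hs]

lemma integrable_kernel_form (f g : L2Pos) :
    Integrable (Function.uncurry fun t s : ℝ =>
      g t * ((((t + s)⁻¹ : ℝ) : ℂ) * (starRingEnd ℂ) (f s))) (halfLine.prod halfLine) := by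
  have hmeasF : AEMeasurable (fun p : ℝ × ℝ => ENNReal.ofReal (p.1 + p.2)⁻¹ * ‖f p.2‖ₑ)
      (halfLine.prod halfLine) :=
    AEMeasurable.mul (Measurable.aemeasurable (by fun_prop)) (aemeasurable_enorm f).comp_snd
  have hmeas : AEStronglyMeasurable (Function.uncurry fun t s : ℝ =>
      g t * ((((t + s)⁻¹ : ℝ) : ℂ) * (starRingEnd ℂ) (f s))) (halfLine.prod halfLine) := by
    refine (Lp.aestronglyMeasurable g).comp_fst.mul (AEStronglyMeasurable.mul
      (Measurable.aestronglyMeasurable (by fun_prop)) ?_)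
    exact Complex.continuous_conj.comp_aestronglyMeasurable (Lp.aestronglyMeasurable f).comp_snd
  refine ⟨hmeas, ?_⟩
  rw [hasFiniteIntegral_iff_enorm, lintegral_prod _ hmeas.enorm]
  have hEq : ∫⁻ t in Ioi (0 : ℝ), ∫⁻ s in Ioi (0 : ℝ), ‖Function.uncurry (fun t s : ℝ =>
      g t * ((((t + s)⁻¹ : ℝ) : ℂ) * (starRingEnd ℂ) (f s))) (t, s)‖ₑ =
      ∫⁻ t in Ioi (0 : ℝ), ((fun t => ‖g t‖ₑ) *
        fun t => ∫⁻ s in Ioi (0 : ℝ), ENNReal.ofReal (t + s)⁻¹ * ‖f s‖ₑ) t := by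
    refine setLIntegral_congr_fun measurableSet_Ioi fun t ht => ?_
    simp only [Pi.mul_apply]
    rw [← lintegral_const_mul' _ _ enorm_ne_top]
    refine setLIntegral_congr_fun measurableSet_Ioi fun s hs => ?_
    rw [← enorm_kernel_mul f ht hs]
    simp only [Function.uncurry, enorm_mul, RCLike.enorm_conj]
  rw [hEq]
  refine (ENNReal.lintegral_mul_le_Lp_mul_Lq halfLine Real.HolderConjugate.two_two
    (aemeasurable_enorm g) hmeasF.lintegral_prod_right').trans_lt ?_
  simp only [ENNReal.rpow_two]
  refine ENNReal.mul_lt_top (ENNReal.rpow_lt_top_of_nonneg (by norm_num) (lintegral_sq_lt_top g).ne)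
    (ENNReal.rpow_lt_top_of_nonneg (by norm_num) ?_)
  exact ((schur_bound (aemeasurable_enorm f)).trans_lt
    (ENNReal.mul_lt_top (by norm_num) (lintegral_sq_lt_top f))).ne

/-- The Carleman operator is self-adjoint. -/
theorem carleman_isSelfAdjoint : IsSelfAdjoint carleman := by
  rw [ContinuousLinearMap.isSelfAdjoint_iff_isSymmetric]
  intro f g
  simp only [ContinuousLinearMap.coe_coe, L2.inner_def, RCLike.inner_apply]
  have h1 : ∫ t in Ioi (0 : ℝ), g t * (starRingEnd ℂ) (carleman f t) =
      ∫ t in Ioi (0 : ℝ), ∫ s in Ioi (0 : ℝ),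
        g t * ((((t + s)⁻¹ : ℝ) : ℂ) * (starRingEnd ℂ) (f s)) := by
    refine integral_congr_ae ?_
    filter_upwards [carleman_apply f] with t ht
    rw [ht, carlemanFun, ← integral_conj, ← integral_const_mul]
    simp only [map_mul, Complex.conj_ofReal]
  have h2 : ∫ s in Ioi (0 : ℝ), carleman g s * (starRingEnd ℂ) (f s) =
      ∫ s in Ioi (0 : ℝ), ∫ t in Ioi (0 : ℝ),
        g t * ((((t + s)⁻¹ : ℝ) : ℂ) * (starRingEnd ℂ) (f s)) := by
    refine integral_congr_ae ?_
    filter_upwards [carleman_apply g] with s hs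
    rw [hs, carlemanFun, ← integral_mul_const]
    refine integral_congr_ae (Eventually.of_forall fun t => ?_)
    simp only [add_comm s t]
    ring
  rw [h1, h2]
  exact integral_integral_swap (integrable_kernel_form f g)

end FiniteRankHankel

end

noncomputable section

namespace FiniteRankHankel

/-! ### Negative spectral subspaces and additive perturbations -/

section Abstract

universe u

variable {E : Type u} [NormedAddCommGroup E] [InnerProductSpace ℂ E] [CompleteSpace E]

/-! The Carleman operator is `L * L` with `L` the Laplace transform, a bounded self-adjoint operator
on `L²(ℝ₊)`, because `∫ exp(-t(s+u)) dt = (s+u)⁻¹` (`carleman_eq_laplace_mul_laplace`). Hence it is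
positive, and by Glazman's lemma adding it to `V` cannot increase the negative multiplicity.

For the reverse inequality, let `P` project onto `Ran V`. The form of `L² + V` at `f` is `‖L f‖² +
⟨V P f, P f⟩`, so it depends only on the pair `(P f, L f)`. If `Ran V ∩ Ran L = 0`, then these pairs
come arbitrarily close to `(e, 0)` for each `e` in `Ran V` (`mem_closure_range_prod`). Approximating
in this way a basis of the negative subspace of `V` gives vectors on whose span the form of `L² + V`
is still negative definite (`negativeMultiplicity_le_add`).

The ranges do meet only in zero (`disjoint_range_laplace`). A finite-rank Hankel range is invariant
under `u ↦ u(· + 1)`, and so is `Ran L`, where the shift acts as multiplication of `g` by `exp(-s)`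
in `L g`. A nonzero finite-dimensional intersection would therefore contain an eigenvector `L g`.
Since `L` is injective (`eq_zero_of_laplace_eq_zero`), this means `exp(-s) g = c g`, which forces `g
= 0`. -/

lemma posPart_isPositive (A : E →L[ℂ] E) : (A⁺ : E →L[ℂ] E).IsPositive :=
  (ContinuousLinearMap.nonneg_iff_isPositive _).1 (CFC.posPart_nonneg A)

lemma negPart_isPositive (A : E →L[ℂ] E) : (A⁻ : E →L[ℂ] E).IsPositive :=
  (ContinuousLinearMap.nonneg_iff_isPositive _).1 (CFC.negPart_nonneg A)

lemma apply_eq_posPart_sub_negPart {A : E →L[ℂ] E} (hA : IsSelfAdjoint A) (x : E) :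
    A x = (A⁺ : E →L[ℂ] E) x - (A⁻ : E →L[ℂ] E) x := by
  conv_lhs => rw [← CFC.posPart_sub_negPart A hA]
  rfl

lemma orthogonal_negativeSpectralSubspace (A : E →L[ℂ] E) :
    (negativeSpectralSubspace A)ᗮ = LinearMap.ker ((A⁻ : E →L[ℂ] E) : E →ₗ[ℂ] E) := by
  rw [negativeSpectralSubspace, Submodule.orthogonal_closure,
    ContinuousLinearMap.orthogonal_range, (negPart_isPositive A).isSelfAdjoint.adjoint_eq]

lemma isClosed_negativeSpectralSubspace (A : E →L[ℂ] E) :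
    IsClosed (negativeSpectralSubspace A : Set E) :=
  Submodule.isClosed_topologicalClosure _

/-- A positive operator annihilates every vector at which its quadratic form vanishes. -/
lemma apply_eq_zero_of_re_inner_eq_zero {A : E →L[ℂ] E} (hA : A.IsPositive) {x : E}
    (hx : (inner ℂ (A x) x).re = 0) : A x = 0 := by
  obtain ⟨S, hS⟩ := CStarAlgebra.nonneg_iff_eq_star_mul_self.1
    ((ContinuousLinearMap.nonneg_iff_isPositive A).2 hA)
  have h : A x = ContinuousLinearMap.adjoint S (S x) := by rw [hS]; rfl
  rw [h, ContinuousLinearMap.adjoint_inner_left] at hx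
  have : S x = 0 := by
    have := inner_self_eq_norm_sq (𝕜 := ℂ) (S x)
    rw [RCLike.re_eq_complex_re, hx] at this
    simpa using this.symm
  rw [h, this, map_zero]

/-- The quadratic form of `A` is negative definite on the negative spectral subspace. -/
lemma re_inner_neg_of_mem_negativeSpectralSubspace {A : E →L[ℂ] E} (hA : IsSelfAdjoint A) {x : E}
    (hx : x ∈ negativeSpectralSubspace A) (hx0 : x ≠ 0) : (inner ℂ (A x) x).re < 0 := by
  have hpos : (A⁺ : E →L[ℂ] E) x = 0 := by
    have hle : negativeSpectralSubspace A ≤ LinearMap.ker ((A⁺ : E →L[ℂ] E) : E →ₗ[ℂ] E) := by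
      refine Submodule.topologicalClosure_minimal _ ?_ (ContinuousLinearMap.isClosed_ker _)
      rintro _ ⟨y, rfl⟩
      exact congrArg (fun B : E →L[ℂ] E => B y) (CFC.posPart_mul_negPart A)
    exact hle hx
  have h0 := (negPart_isPositive A).re_inner_nonneg_left x
  rw [apply_eq_posPart_sub_negPart hA, hpos, zero_sub, inner_neg_left, Complex.neg_re, neg_lt_zero]
  refine lt_of_le_of_ne h0 fun h => hx0 ?_
  have hk : x ∈ (negativeSpectralSubspace A)ᗮ := by
    rw [orthogonal_negativeSpectralSubspace]
    exact apply_eq_zero_of_re_inner_eq_zero (negPart_isPositive A) h.symm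
  exact inner_self_eq_zero.1 (hk x hx)

/-- Glazman's lemma: a space on which the form of `A` is negative definite has dimension at most
that of the negative spectral subspace. -/
lemma rank_le_rank_negativeSpectralSubspace {A : E →L[ℂ] E} (hA : IsSelfAdjoint A)
    {M : Type u} [AddCommGroup M] [Module ℂ M] (J : M →ₗ[ℂ] E)
    (hJ : ∀ m, m ≠ 0 → (inner ℂ (A (J m)) (J m)).re < 0) :
    Module.rank ℂ M ≤ Module.rank ℂ (negativeSpectralSubspace A) := by
  have : CompleteSpace (negativeSpectralSubspace A) :=
    (isClosed_negativeSpectralSubspace A).completeSpace_coe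
  -- The orthogonal projection onto the negative subspace is injective on the image of `J`: a vector
  -- it kills lies in `ker A⁻`, where the form of `A` is that of `A⁺`, hence nonnegative.
  refine LinearMap.rank_le_of_injective
    (((negativeSpectralSubspace A).orthogonalProjectionOnto : E →ₗ[ℂ] _) ∘ₗ J) ?_
  rw [injective_iff_map_eq_zero]
  intro m hm
  by_contra h0
  have hk : J m ∈ (negativeSpectralSubspace A)ᗮ :=
    Submodule.orthogonalProjectionOnto_eq_zero_iff.1 hm
  rw [orthogonal_negativeSpectralSubspace] at hk
  have hk : (A⁻ : E →L[ℂ] E) (J m) = 0 := hk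
  have h1 := hJ m h0
  rw [apply_eq_posPart_sub_negPart hA, hk, sub_zero] at h1
  exact absurd ((posPart_isPositive A).re_inner_nonneg_left (J m)) (not_le.2 h1)

lemma isPositive_iff_negativeMultiplicity_eq_zero {A : E →L[ℂ] E} (hA : IsSelfAdjoint A) :
    A.IsPositive ↔ negativeMultiplicity A = 0 := by
  rw [← ContinuousLinearMap.nonneg_iff_isPositive, ← CFC.negPart_eq_zero_iff A hA,
    negativeMultiplicity, Cardinal.toENat_eq_zero, Submodule.rank_eq_zero]
  constructor
  · intro h
    rw [negativeSpectralSubspace, h, eq_bot_iff]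
    refine Submodule.topologicalClosure_minimal _ ?_ ?_
    · rintro _ ⟨y, rfl⟩
      simp
    · simp
  · intro h
    ext x
    have : (A⁻ : E →L[ℂ] E) x ∈ negativeSpectralSubspace A :=
      Submodule.le_topologicalClosure _ ⟨x, rfl⟩
    rw [h] at this
    simpa using this

/-- Adding a positive operator does not increase the number of negative eigenvalues. -/
lemma negativeMultiplicity_add_le {A B : E →L[ℂ] E} (hA : A.IsPositive) (hB : IsSelfAdjoint B) :
    negativeMultiplicity (A + B) ≤ negativeMultiplicity B := by
  refine OrderHomClass.mono Cardinal.toENat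
    (rank_le_rank_negativeSpectralSubspace hB (negativeSpectralSubspace (A + B)).subtype ?_)
  intro x hx
  have h := re_inner_neg_of_mem_negativeSpectralSubspace (hA.isSelfAdjoint.add hB) x.2
    (by simpa using hx)
  have hpos := hA.re_inner_nonneg_left (x : E)
  rw [add_apply, inner_add_left, Complex.add_re] at h
  rw [RCLike.re_eq_complex_re] at hpos
  simp only [Submodule.subtype_apply]
  linarith

/-- Definiteness of the form makes `V` injective on this subspace, which therefore embeds in the
range of `V`. -/
lemma finiteDimensional_negativeSpectralSubspace {V : E →L[ℂ] E} (hV : IsSelfAdjoint V)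
    [FiniteDimensional ℂ (LinearMap.range (V : E →ₗ[ℂ] E))] :
    FiniteDimensional ℂ (negativeSpectralSubspace V) := by
  refine FiniteDimensional.of_injective
    ((V : E →ₗ[ℂ] E).rangeRestrict ∘ₗ (negativeSpectralSubspace V).subtype) ?_
  rw [injective_iff_map_eq_zero]
  intro x hx
  by_contra h0
  have h := re_inner_neg_of_mem_negativeSpectralSubspace hV x.2 (by simpa using h0)
  have : V x = 0 := congrArg Subtype.val hx
  rw [this] at h
  simp at h

/-- A finite-dimensional range is closed, hence equals `(ker V)ᗮ`; so it is enough that `V y = 0`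
implies `V⁻ y = 0`. -/
lemma negativeSpectralSubspace_le_range {V : E →L[ℂ] E} (hV : IsSelfAdjoint V)
    [FiniteDimensional ℂ (LinearMap.range (V : E →ₗ[ℂ] E))] :
    negativeSpectralSubspace V ≤ LinearMap.range (V : E →ₗ[ℂ] E) := by
  rw [← (LinearMap.range (V : E →ₗ[ℂ] E)).orthogonal_orthogonal,
    ContinuousLinearMap.orthogonal_range, hV.adjoint_eq]
  intro x hx
  rw [Submodule.mem_orthogonal]
  intro y hy
  have hy : V y = 0 := hy
  have hk : y ∈ (negativeSpectralSubspace V)ᗮ := by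
    rw [orthogonal_negativeSpectralSubspace]
    refine apply_eq_zero_of_re_inner_eq_zero (negPart_isPositive V) ?_
    -- On `ker V` the two parts agree, and `V⁻ V⁺ = 0` then gives `V⁻ (V⁻ y) = 0`.
    have h1 : (V⁺ : E →L[ℂ] E) y = (V⁻ : E →L[ℂ] E) y := by
      rw [← sub_eq_zero, ← apply_eq_posPart_sub_negPart hV, hy]
    have h2 : (V⁻ : E →L[ℂ] E) ((V⁻ : E →L[ℂ] E) y) = 0 := by
      conv_lhs => rw [← h1]
      exact congrArg (fun B : E →L[ℂ] E => B y) (CFC.negPart_mul_posPart V)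
    have h3 : (V⁻ : E →L[ℂ] E) y = 0 := by
      rw [← inner_self_eq_zero (𝕜 := ℂ), ← (negPart_isPositive V).inner_left_eq_inner_right, h2,
        inner_zero_left]
    rw [h3, inner_zero_left, Complex.zero_re]
  rw [inner_eq_zero_symm]
  exact hk x hx

/-- If the ranges of a projection and of a self-adjoint operator `L` meet only in zero, then the
pairs `(P f, L f)` approximate every pair `(e, 0)` with `e` in the range of `P`. -/
lemma mem_closure_range_prod {R : Submodule ℂ E} [R.HasOrthogonalProjection] {L : E →L[ℂ] E}
    (hL : IsSelfAdjoint L) (hRL : Disjoint R (LinearMap.range (L : E →ₗ[ℂ] E))) {e : E}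
    (he : e ∈ R) :
    ((e, 0) : E × E) ∈ closure (range fun f => (R.starProjection f, L f)) := by
  -- The product `E × E` carries the sup norm; `WithLp 2` supplies the inner product needed to
  -- compute the closure as a double orthogonal complement.
  set Ψ : E →L[ℂ] WithLp 2 (E × E) :=
    (WithLp.prodContinuousLinearEquiv 2 ℂ E E).symm.toContinuousLinearMap ∘L
      (R.starProjection.prod L) with hΨ
  have key : (WithLp.toLp 2 (e, 0) : WithLp 2 (E × E)) ∈
      (LinearMap.range (Ψ : E →ₗ[ℂ] WithLp 2 (E × E))).topologicalClosure := by
    rw [← Submodule.orthogonal_orthogonal_eq_closure, Submodule.mem_orthogonal]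
    intro y hy
    have hy' : ∀ f, inner ℂ (R.starProjection f) y.fst + inner ℂ (L f) y.snd = 0 := fun f => by
      have := hy (Ψ f) ⟨f, rfl⟩
      rw [WithLp.prod_inner_apply] at this
      exact this
    have hz : R.starProjection y.fst + L y.snd = 0 := by
      refine ext_inner_left ℂ fun f => ?_
      rw [inner_add_right, inner_zero_right, ← Submodule.inner_starProjection_left_eq_right]
      have h2 : inner ℂ f (L y.snd) = inner ℂ (L f) y.snd :=
        ((ContinuousLinearMap.isSelfAdjoint_iff_isSymmetric.1 hL) f y.snd).symm
      rw [h2]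
      exact hy' f
    have h0 : R.starProjection y.fst = 0 := by
      -- Orthogonality of `y` to all pairs reads `P y₁ + L y₂ = 0`, so `P y₁` lies in both ranges
      -- and vanishes.
      refine Submodule.disjoint_def.1 hRL _ (Submodule.starProjection_apply_mem _ _) ⟨-y.snd, ?_⟩
      simp only [map_neg, ContinuousLinearMap.coe_coe]
      exact (eq_neg_of_add_eq_zero_left hz).symm
    rw [WithLp.prod_inner_apply]
    have h1 : inner ℂ y.fst e = 0 := by
      rw [← Submodule.starProjection_eq_self_iff.2 he,
        ← Submodule.inner_starProjection_left_eq_right, h0, inner_zero_left]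
    simpa using h1
  have h3 := mem_closure_image (WithLp.prodContinuousLinearEquiv 2 ℂ E E).continuous.continuousAt
    (s := range Ψ) (x := WithLp.toLp 2 (e, 0)) key
  rw [← range_comp] at h3
  exact h3

/-- Since `V` is self-adjoint, `ker V` is the orthogonal complement of its range, so the form sees
only the component of `f` in the range. -/
lemma inner_apply_starProjection_range {V : E →L[ℂ] E} (hV : IsSelfAdjoint V)
    [(LinearMap.range (V : E →ₗ[ℂ] E)).HasOrthogonalProjection] (f : E) :
    inner ℂ (V ((LinearMap.range (V : E →ₗ[ℂ] E)).starProjection f))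
      ((LinearMap.range (V : E →ₗ[ℂ] E)).starProjection f) = inner ℂ (V f) f := by
  set P := (LinearMap.range (V : E →ₗ[ℂ] E)).starProjection with hP
  have h1 : V (P f) = V f := by
    have : f - P f ∈ (LinearMap.range (V : E →ₗ[ℂ] E))ᗮ :=
      Submodule.sub_starProjection_mem_orthogonal _
    rw [ContinuousLinearMap.orthogonal_range, hV.adjoint_eq] at this
    have : V (f - P f) = 0 := this
    rw [map_sub, sub_eq_zero] at this
    exact this.symm
  rw [h1, ← Submodule.inner_starProjection_left_eq_right,
    Submodule.starProjection_eq_self_iff.2 (⟨f, rfl⟩ : V f ∈ LinearMap.range (V : E →ₗ[ℂ] E))]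

/-- If `V` is self-adjoint of finite rank and the ranges of `V` and of the self-adjoint operator `L`
meet only in zero, then adding `L²` to `V` does not destroy negative eigenvalues. -/
lemma negativeMultiplicity_le_add {V L : E →L[ℂ] E} (hV : IsSelfAdjoint V)
    [FiniteDimensional ℂ (LinearMap.range (V : E →ₗ[ℂ] E))] (hL : IsSelfAdjoint L)
    (hdisj : Disjoint (LinearMap.range (V : E →ₗ[ℂ] E)) (LinearMap.range (L : E →ₗ[ℂ] E))) :
    negativeMultiplicity V ≤ negativeMultiplicity (L * L + V) := by
  have := finiteDimensional_negativeSpectralSubspace hV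
  set R := LinearMap.range (V : E →ₗ[ℂ] E) with hR
  set N := negativeSpectralSubspace V
  set b := Module.finBasis ℂ N
  set ι := Fin (Module.finrank ℂ N)
  -- When `x i = (P (f i), L (f i))`, this is the form of `L² + V` at `∑ c i • f i`; when `x i = (b
  -- i, 0)`, it is the form of `V` on `N`.
  let Q : (ι → E × E) → (ι → ℂ) → ℝ := fun x c =>
    ‖∑ i, c i • (x i).2‖ ^ 2 + (inner ℂ (V (∑ i, c i • (x i).1)) (∑ i, c i • (x i).1)).re
  have hQ : Continuous fun z : (ι → E × E) × (ι → ℂ) => Q z.1 z.2 := by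
    simp only [Q]
    fun_prop
  have hlc : ∀ c : ι → ℂ, (∑ i, c i • (b i : E)) = ((b.equivFun.symm c : N) : E) := fun c => by
    simp [Module.Basis.equivFun_symm_apply]
  -- Compactness of the coefficient sphere turns negativity for each `c` at the base point into
  -- negativity for all `c` on one neighbourhood.
  have hnear : ∀ᶠ x in nhds (fun i => ((b i : E), (0 : E))),
      ∀ c ∈ Metric.sphere (0 : ι → ℂ) 1, Q x c < 0 := by
    refine (isCompact_sphere _ _).eventually_forall_of_forall_eventually fun c hc => ?_
    refine hQ.continuousAt.eventually_lt continuousAt_const ?_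
    have hc0 : c ≠ 0 := by
      rintro rfl
      simp at hc
    simp only [Q, hlc]
    simp only [smul_zero, Finset.sum_const_zero, norm_zero]
    rw [zero_pow two_ne_zero, zero_add]
    exact re_inner_neg_of_mem_negativeSpectralSubspace hV (b.equivFun.symm c).2
      fun h => hc0 (b.equivFun.symm.map_eq_zero_iff.1 (Subtype.ext h))
  have hcl : (fun i => ((b i : E), (0 : E))) ∈
      closure (Set.pi univ fun _ : ι => range fun f => (R.starProjection f, L f)) := by
    rw [closure_pi_set]
    exact fun i _ => mem_closure_range_prod hL hdisj (negativeSpectralSubspace_le_range hV (b i).2)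
  obtain ⟨x, hx, hxmem⟩ := (mem_closure_iff_frequently.1 hcl).and_eventually hnear |>.exists
  choose f hf using fun i => hx i (mem_univ i)
  -- Linear independence of the `f i` need not be checked: it follows from strict negativity of the
  -- form along `J`.
  let J : N →ₗ[ℂ] E := Fintype.linearCombination ℂ f ∘ₗ (b.equivFun : N →ₗ[ℂ] ι → ℂ)
  have hform : ∀ c : ι → ℂ, (inner ℂ ((L * L + V) (∑ i, c i • f i)) (∑ i, c i • f i)).re =
      Q x c := by
    intro c
    have h1 : ∑ i, c i • (x i).1 = R.starProjection (∑ i, c i • f i) := by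
      simp only [← hf, map_sum, map_smul]
    have h2 : ∑ i, c i • (x i).2 = L (∑ i, c i • f i) := by
      simp only [← hf, map_sum, map_smul]
    simp only [Q]
    rw [h1, h2, inner_apply_starProjection_range hV, add_apply, inner_add_left,
      Complex.add_re]
    congr 1
    rw [← inner_self_eq_norm_sq (𝕜 := ℂ), mul_apply_eq_comp]
    exact congrArg Complex.re ((ContinuousLinearMap.isSelfAdjoint_iff_isSymmetric.1 hL) _ _)
  have hsa : IsSelfAdjoint (L * L + V) := by
    refine IsSelfAdjoint.add ?_ hV
    simpa [hL.star_eq] using IsSelfAdjoint.star_mul_self L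
  refine OrderHomClass.mono Cardinal.toENat (rank_le_rank_negativeSpectralSubspace hsa J ?_)
  intro m hm
  set c := b.equivFun m
  have hc : c ≠ 0 := by simpa [c] using hm
  have hc' : 0 < ‖c‖ := norm_pos_iff.2 hc
  -- Homogeneity of the form allows `c` to be normalised to the unit sphere.
  have hneg := hxmem (((‖c‖⁻¹ : ℝ) : ℂ) • c) (by
    simp [norm_smul, hc'.ne'])
  have hJ : J m = ∑ i, c i • f i := by simp [J, c, Fintype.linearCombination_apply]
  rw [← hform] at hneg
  simp only [Pi.smul_apply, smul_assoc, ← Finset.smul_sum] at hneg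
  rw [map_smul, inner_smul_left, inner_smul_right, Complex.conj_ofReal, Complex.re_ofReal_mul,
    Complex.re_ofReal_mul] at hneg
  rw [hJ]
  have hinv : 0 < ‖c‖⁻¹ := inv_pos.2 hc'
  exact neg_of_mul_neg_right (neg_of_mul_neg_right hneg hinv.le) hinv.le

end Abstract

/-! ### The Laplace transform as a square root of the Carleman operator -/

section Laplace

lemma integrable_exp_neg_mul {a : ℝ} (ha : 0 < a) :
    Integrable (fun t : ℝ => Real.exp (-(t * a))) halfLine := by
  have := integrableOn_exp_mul_Ioi (neg_lt_zero.2 ha) 0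
  refine this.congr (Eventually.of_forall fun t => ?_)
  simp only
  congr 1; ring

lemma integral_exp_neg_mul {a : ℝ} (ha : 0 < a) :
    ∫ t in Ioi (0 : ℝ), Real.exp (-(t * a)) = a⁻¹ := by
  have := integral_exp_mul_Ioi (neg_lt_zero.2 ha) 0
  rw [mul_zero, Real.exp_zero, neg_div_neg_eq, one_div] at this
  rw [← this]
  refine integral_congr_ae (Eventually.of_forall fun t => ?_)
  simp only
  congr 1; ring

lemma lintegral_exp_neg_mul {a : ℝ} (ha : 0 < a) :
    ∫⁻ t in Ioi (0 : ℝ), ENNReal.ofReal (Real.exp (-(t * a))) = ENNReal.ofReal a⁻¹ := by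
  rw [← integral_exp_neg_mul ha, ofReal_integral_eq_lintegral_ofReal (integrable_exp_neg_mul ha)]
  exact Eventually.of_forall fun t => (Real.exp_pos _).le

/-- The Laplace transform of a nonnegative function. -/
def laplaceENN (F : ℝ → ℝ≥0∞) (t : ℝ) : ℝ≥0∞ :=
  ∫⁻ s in Ioi (0 : ℝ), ENNReal.ofReal (Real.exp (-(t * s))) * F s

lemma measurable_laplaceENN {F : ℝ → ℝ≥0∞} (hF : Measurable F) : Measurable (laplaceENN F) :=
  Measurable.lintegral_prod_right' (f := fun p : ℝ × ℝ =>
    ENNReal.ofReal (Real.exp (-(p.1 * p.2))) * F p.2) (by fun_prop)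

/-- Expand the square and apply Tonelli: the `t`-integral of `exp(-t(s+u))` is `(s+u)⁻¹`. This
reduces boundedness of the Laplace transform to the Schur test for the Carleman kernel. -/
lemma lintegral_laplaceENN_sq {F : ℝ → ℝ≥0∞} (hF : Measurable F) :
    ∫⁻ t in Ioi (0 : ℝ), laplaceENN F t ^ 2 =
      ∫⁻ s in Ioi (0 : ℝ), F s * ∫⁻ u in Ioi (0 : ℝ), ENNReal.ofReal (s + u)⁻¹ * F u := by
  calc _ = ∫⁻ t in Ioi (0 : ℝ), ∫⁻ s in Ioi (0 : ℝ),
        ENNReal.ofReal (Real.exp (-(t * s))) * F s * laplaceENN F t := by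
        refine lintegral_congr fun t => ?_
        rw [lintegral_mul_const _ (by fun_prop), sq]
        rfl
    _ = ∫⁻ s in Ioi (0 : ℝ), ∫⁻ t in Ioi (0 : ℝ),
        ENNReal.ofReal (Real.exp (-(t * s))) * F s * laplaceENN F t := by
        refine lintegral_lintegral_swap (Measurable.aemeasurable ?_)
        have := measurable_laplaceENN hF
        fun_prop
    _ = ∫⁻ s in Ioi (0 : ℝ), ∫⁻ t in Ioi (0 : ℝ), ∫⁻ u in Ioi (0 : ℝ),
        ENNReal.ofReal (Real.exp (-(t * s))) * F s *
          (ENNReal.ofReal (Real.exp (-(t * u))) * F u) := by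
        refine lintegral_congr fun s => lintegral_congr fun t => ?_
        rw [lintegral_const_mul _ (by fun_prop)]
        rfl
    _ = ∫⁻ s in Ioi (0 : ℝ), ∫⁻ u in Ioi (0 : ℝ), ∫⁻ t in Ioi (0 : ℝ),
        ENNReal.ofReal (Real.exp (-(t * s))) * F s *
          (ENNReal.ofReal (Real.exp (-(t * u))) * F u) := by
        refine lintegral_congr fun s => lintegral_lintegral_swap (Measurable.aemeasurable ?_)
        fun_prop
    _ = _ := by
        refine setLIntegral_congr_fun measurableSet_Ioi fun s hs => ?_
        rw [← lintegral_const_mul _ (by fun_prop)]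
        refine setLIntegral_congr_fun measurableSet_Ioi fun u hu => ?_
        rw [← lintegral_exp_neg_mul (add_pos hs hu), ← lintegral_mul_const _ (by fun_prop),
          ← lintegral_const_mul _ (by fun_prop)]
        refine lintegral_congr fun t => ?_
        rw [mul_add, neg_add, Real.exp_add, ENNReal.ofReal_mul (Real.exp_pos _).le]
        ring

lemma lintegral_mul_le_sqrt {F G : ℝ → ℝ≥0∞} (hF : Measurable F) (hG : AEMeasurable G halfLine) :
    ∫⁻ s in Ioi (0 : ℝ), F s * G s ≤ (∫⁻ s in Ioi (0 : ℝ), F s ^ 2) ^ (1 / 2 : ℝ) *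
      (∫⁻ s in Ioi (0 : ℝ), G s ^ 2) ^ (1 / 2 : ℝ) := by
  have := ENNReal.lintegral_mul_le_Lp_mul_Lq halfLine Real.HolderConjugate.two_two
    hF.aemeasurable hG
  simpa only [ENNReal.rpow_two, Pi.mul_apply] using this

/-- Cauchy–Schwarz with `schur_bound`; the constant is `√16`. -/
lemma lintegral_laplaceENN_sq_le {F : ℝ → ℝ≥0∞} (hF : Measurable F) :
    ∫⁻ t in Ioi (0 : ℝ), laplaceENN F t ^ 2 ≤ 4 * ∫⁻ s in Ioi (0 : ℝ), F s ^ 2 := by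
  rw [lintegral_laplaceENN_sq hF]
  have hm : Measurable fun s => ∫⁻ u in Ioi (0 : ℝ), ENNReal.ofReal (s + u)⁻¹ * F u :=
    Measurable.lintegral_prod_right' (f := fun p : ℝ × ℝ =>
      ENNReal.ofReal (p.1 + p.2)⁻¹ * F p.2) (by fun_prop)
  refine (lintegral_mul_le_sqrt hF hm.aemeasurable).trans ?_
  refine (mul_le_mul_right (ENNReal.rpow_le_rpow (schur_bound hF.aemeasurable)
    (by norm_num)) _).trans ?_
  rw [ENNReal.mul_rpow_of_nonneg _ _ (by norm_num)]
  have h16 : (16 : ℝ≥0∞) ^ (1 / 2 : ℝ) = 4 := by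
    rw [show (16 : ℝ≥0∞) = 4 ^ (2 : ℝ) by norm_num, ← ENNReal.rpow_mul]
    norm_num
  rw [h16, mul_left_comm, ← ENNReal.rpow_add_of_nonneg _ _ (by norm_num) (by norm_num)]
  norm_num

/-- The function `t ↦ ∫₀^∞ exp(-t s) f(s) ds`. -/
def laplaceFun (f : L2Pos) (t : ℝ) : ℂ := ∫ s in Ioi (0 : ℝ), (Real.exp (-(t * s)) : ℂ) * f s

lemma measurable_coeFn (f : L2Pos) : Measurable f := (Lp.stronglyMeasurable f).measurable

lemma enorm_exp_mul (f : L2Pos) (t s : ℝ) :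
    ‖(Real.exp (-(t * s)) : ℂ) * f s‖ₑ = ENNReal.ofReal (Real.exp (-(t * s))) * ‖f s‖ₑ := by
  rw [enorm_mul]
  congr 1
  rw [← ofReal_norm, Complex.norm_real, Real.norm_of_nonneg (Real.exp_pos _).le]

lemma enorm_laplaceFun_le (f : L2Pos) (t : ℝ) :
    ‖laplaceFun f t‖ₑ ≤ laplaceENN (fun s => ‖f s‖ₑ) t :=
  (enorm_integral_le_lintegral_enorm _).trans
    (le_of_eq (lintegral_congr fun s => enorm_exp_mul f t s))

lemma measurable_enorm_coeFn (f : L2Pos) : Measurable fun s => ‖f s‖ₑ :=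
  (measurable_coeFn f).enorm

lemma eLpNorm_laplaceFun_le (f : L2Pos) :
    eLpNorm (laplaceFun f) 2 halfLine ≤ 2 * eLpNorm f 2 halfLine := by
  have h : eLpNorm (laplaceFun f) 2 halfLine ^ 2 ≤ (2 * eLpNorm f 2 halfLine) ^ 2 := by
    rw [mul_pow, eLpNorm_two_sq, eLpNorm_two_sq]
    refine (lintegral_mono fun t => pow_le_pow_left' (enorm_laplaceFun_le f t) 2).trans
      ((lintegral_laplaceENN_sq_le (measurable_enorm_coeFn f)).trans (le_of_eq ?_))
    norm_num
  exact (ENNReal.pow_le_pow_left_iff two_ne_zero).1 h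

lemma memLp_laplaceFun (f : L2Pos) : MemLp (laplaceFun f) 2 halfLine := by
  refine ⟨?_, (eLpNorm_laplaceFun_le f).trans_lt
    (ENNReal.mul_lt_top (by norm_num) (Lp.eLpNorm_lt_top f))⟩
  have hm := measurable_coeFn f
  exact AEStronglyMeasurable.integral_prod_right' (f := fun p : ℝ × ℝ =>
    (Real.exp (-(p.1 * p.2)) : ℂ) * f p.2) (Measurable.aestronglyMeasurable (by fun_prop))

lemma memLp_exp_neg_mul {t : ℝ} (ht : 0 < t) :
    MemLp (fun s : ℝ => (Real.exp (-(t * s)) : ℂ)) 2 halfLine := by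
  refine (memLp_two_iff_integrable_sq_norm
    (Measurable.aestronglyMeasurable (by fun_prop))).2 ?_
  refine (integrable_exp_neg_mul (mul_pos two_pos ht)).congr (Eventually.of_forall fun s => ?_)
  simp only [Complex.norm_real, Real.norm_of_nonneg (Real.exp_pos _).le]
  rw [sq, ← Real.exp_add]
  congr 1; ring

lemma integrable_exp_mul (f : L2Pos) {t : ℝ} (ht : 0 < t) :
    Integrable (fun s => (Real.exp (-(t * s)) : ℂ) * f s) halfLine :=
  (memLp_exp_neg_mul ht).integrable_mul (Lp.memLp f)

/-- The Laplace transform as a bounded operator on `L²(ℝ₊)`. -/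
def laplace : L2Pos →L[ℂ] L2Pos :=
  LinearMap.mkContinuous
    { toFun := fun f => (memLp_laplaceFun f).toLp (laplaceFun f)
      map_add' := fun f g => by
        rw [← MemLp.toLp_add]
        refine MemLp.toLp_congr _ _ ?_
        filter_upwards [ae_restrict_mem measurableSet_Ioi] with t ht
        simp only [Pi.add_apply, laplaceFun]
        rw [← integral_add (integrable_exp_mul f ht) (integrable_exp_mul g ht)]
        refine integral_congr_ae ?_
        filter_upwards [Lp.coeFn_add f g] with s hs
        rw [hs, Pi.add_apply, mul_add]
      map_smul' := fun c f => by
        rw [RingHom.id_apply, ← MemLp.toLp_const_smul]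
        refine MemLp.toLp_congr _ _ (Eventually.of_forall fun t => ?_)
        simp only [Pi.smul_apply, laplaceFun]
        rw [← integral_smul]
        refine integral_congr_ae ?_
        filter_upwards [Lp.coeFn_smul c f] with s hs
        rw [hs, Pi.smul_apply, smul_eq_mul, smul_eq_mul]
        ring }
    2
    (fun f => by
      rw [LinearMap.coe_mk, AddHom.coe_mk, Lp.norm_toLp, Lp.norm_def]
      have h := ENNReal.toReal_mono
        (ENNReal.mul_lt_top (by norm_num) (Lp.eLpNorm_lt_top f)).ne (eLpNorm_laplaceFun_le f)
      rw [ENNReal.toReal_mul] at h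
      simpa using h)

lemma laplace_apply (f : L2Pos) : laplace f =ᵐ[halfLine] laplaceFun f :=
  MemLp.coeFn_toLp (memLp_laplaceFun f)

lemma integrable_laplace_form (f g : L2Pos) :
    Integrable (Function.uncurry fun t s : ℝ =>
      g t * ((Real.exp (-(t * s)) : ℂ) * (starRingEnd ℂ) (f s))) (halfLine.prod halfLine) := by
  have hf := measurable_coeFn f
  have hg := measurable_coeFn g
  have hmeas : Measurable (Function.uncurry fun t s : ℝ =>
      g t * ((Real.exp (-(t * s)) : ℂ) * (starRingEnd ℂ) (f s))) := by
    have : Measurable fun s => (starRingEnd ℂ) (f s) := Complex.continuous_conj.measurable.comp hf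
    simp only [Function.uncurry_def]
    fun_prop
  refine ⟨hmeas.aestronglyMeasurable, ?_⟩
  rw [hasFiniteIntegral_iff_enorm, lintegral_prod _ hmeas.enorm.aemeasurable]
  have hEq : ∀ t, ∫⁻ s in Ioi (0 : ℝ), ‖Function.uncurry (fun t s : ℝ =>
      g t * ((Real.exp (-(t * s)) : ℂ) * (starRingEnd ℂ) (f s))) (t, s)‖ₑ =
      ‖g t‖ₑ * laplaceENN (fun s => ‖f s‖ₑ) t := fun t => by
    rw [laplaceENN, ← lintegral_const_mul' _ _ enorm_ne_top]
    refine lintegral_congr fun s => ?_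
    rw [← enorm_exp_mul f]
    simp only [Function.uncurry, enorm_mul, RCLike.enorm_conj]
  simp only [hEq]
  refine (lintegral_mul_le_sqrt (measurable_enorm_coeFn g)
    (measurable_laplaceENN (measurable_enorm_coeFn f)).aemeasurable).trans_lt ?_
  refine ENNReal.mul_lt_top (ENNReal.rpow_lt_top_of_nonneg (by norm_num) (lintegral_sq_lt_top g).ne)
    (ENNReal.rpow_lt_top_of_nonneg (by norm_num) ?_)
  exact ((lintegral_laplaceENN_sq_le (measurable_enorm_coeFn f)).trans_lt
    (ENNReal.mul_lt_top (by norm_num) (lintegral_sq_lt_top f))).ne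

theorem laplace_isSelfAdjoint : IsSelfAdjoint laplace := by
  rw [ContinuousLinearMap.isSelfAdjoint_iff_isSymmetric]
  intro f g
  simp only [ContinuousLinearMap.coe_coe, L2.inner_def, RCLike.inner_apply]
  have h1 : ∫ t in Ioi (0 : ℝ), g t * (starRingEnd ℂ) (laplace f t) =
      ∫ t in Ioi (0 : ℝ), ∫ s in Ioi (0 : ℝ),
        g t * ((Real.exp (-(t * s)) : ℂ) * (starRingEnd ℂ) (f s)) := by
    refine integral_congr_ae ?_
    filter_upwards [laplace_apply f] with t ht
    rw [ht, laplaceFun, ← integral_conj, ← integral_const_mul]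
    simp only [map_mul, Complex.conj_ofReal]
  have h2 : ∫ s in Ioi (0 : ℝ), laplace g s * (starRingEnd ℂ) (f s) =
      ∫ s in Ioi (0 : ℝ), ∫ t in Ioi (0 : ℝ),
        g t * ((Real.exp (-(t * s)) : ℂ) * (starRingEnd ℂ) (f s)) := by
    refine integral_congr_ae ?_
    filter_upwards [laplace_apply g] with s hs
    rw [hs, laplaceFun, ← integral_mul_const]
    refine integral_congr_ae (Eventually.of_forall fun t => ?_)
    simp only [mul_comm s t]
    ring
  rw [h1, h2]
  exact integral_integral_swap (integrable_laplace_form f g)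

/-- The Carleman operator is the square of the Laplace transform. -/
theorem carleman_eq_laplace_mul_laplace : carleman = laplace * laplace := by
  ext1 f
  refine Lp.ext ?_
  rw [mul_apply_eq_comp]
  filter_upwards [carleman_apply f, laplace_apply (laplace f), ae_integrable_kernel_mul f,
    ae_restrict_mem measurableSet_Ioi] with t h1 h2 h3 ht
  have ht : 0 < t := ht
  have hm := measurable_coeFn f
  rw [h1, h2, carlemanFun, laplaceFun]
  have hint : Integrable (Function.uncurry fun s u : ℝ =>
      ((Real.exp (-(t * s)) * Real.exp (-(s * u)) : ℝ) : ℂ) * f u) (halfLine.prod halfLine) := by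
    have hme : Measurable (Function.uncurry fun s u : ℝ =>
        ((Real.exp (-(t * s)) * Real.exp (-(s * u)) : ℝ) : ℂ) * f u) := by
      simp only [Function.uncurry_def]
      fun_prop
    have hexp : ∀ s u : ℝ, Real.exp (-(t * s)) * Real.exp (-(s * u)) =
        Real.exp (-(s * (t + u))) := fun s u => by
      rw [← Real.exp_add]; congr 1; ring
    refine (integrable_prod_iff' hme.aestronglyMeasurable).2 ⟨?_, ?_⟩
    · filter_upwards [ae_restrict_mem measurableSet_Ioi] with u hu
      simp only [Function.uncurry_apply_pair, hexp]
      exact (integrable_exp_neg_mul (add_pos ht hu)).ofReal.mul_const _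
    -- Integrating the absolute value in `s` leaves `|f u| / (t + u)`, whose integrability in `u` is
    -- known for almost every `t`.
    · refine h3.norm.congr ?_
      filter_upwards [ae_restrict_mem measurableSet_Ioi] with u hu
      have hu : 0 < u := hu
      simp only [Function.uncurry_apply_pair, hexp, norm_mul, Complex.norm_real,
        Real.norm_of_nonneg (Real.exp_pos _).le]
      rw [integral_mul_const, integral_exp_neg_mul (add_pos ht hu),
        Real.norm_of_nonneg (by positivity)]
  calc _ = ∫ u in Ioi (0 : ℝ), ∫ s in Ioi (0 : ℝ),
        ((Real.exp (-(t * s)) * Real.exp (-(s * u)) : ℝ) : ℂ) * f u := by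
        refine setIntegral_congr_fun measurableSet_Ioi fun u hu => ?_
        rw [integral_mul_const, integral_complex_ofReal, ← integral_exp_neg_mul (add_pos ht hu)]
        congr 3
        ext s
        rw [← Real.exp_add]; congr 1; ring
    _ = ∫ s in Ioi (0 : ℝ), ∫ u in Ioi (0 : ℝ),
        ((Real.exp (-(t * s)) * Real.exp (-(s * u)) : ℝ) : ℂ) * f u :=
        (integral_integral_swap hint).symm
    _ = _ := by
        refine integral_congr_ae ?_
        filter_upwards [laplace_apply f] with s hs
        rw [hs, laplaceFun, ← integral_const_mul]
        simp only [Complex.ofReal_mul, mul_assoc]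

theorem carleman_isPositive : carleman.IsPositive := by
  rw [carleman_eq_laplace_mul_laplace]
  have := ContinuousLinearMap.isPositive_adjoint_comp_self laplace
  rwa [laplace_isSelfAdjoint.adjoint_eq] at this

end Laplace

/-! ### Density of test functions -/

section TestFunctions

lemma setIntegral_eq_integral_of_tsupport_subset {φ : ℝ → ℂ} {a : ℝ} (hφ : tsupport φ ⊆ Ioi a)
    (g : ℝ → ℂ) : ∫ s in Ioi a, g s * φ s = ∫ s, g s * φ s := by
  refine setIntegral_eq_integral_of_forall_compl_eq_zero fun s hs => ?_
  rw [image_eq_zero_of_notMem_tsupport fun h => hs (hφ h), mul_zero]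

lemma eq_zero_of_forall_integral_eq_zero {g : L2Pos}
    (h : ∀ ψ : ℝ → ℝ, Continuous ψ → HasCompactSupport ψ → tsupport ψ ⊆ Ioi 0 →
      ∫ s in Ioi (0 : ℝ), (ψ s : ℂ) * g s = 0) : g = 0 := by
  have hloc : LocallyIntegrableOn g (Ioi 0) :=
    locallyIntegrableOn_of_locallyIntegrable_restrict ((Lp.memLp g).locallyIntegrable (by norm_num))
  have h0 := isOpen_Ioi.ae_eq_zero_of_integral_contDiff_smul_eq_zero hloc fun ψ hψ hc hs => by
    rw [← h ψ hψ.continuous hc hs]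
    rw [setIntegral_eq_integral_of_forall_compl_eq_zero fun s hs' => ?_]
    · rfl
    · rw [image_eq_zero_of_notMem_tsupport fun h => hs' (hs h), Complex.ofReal_zero, zero_mul]
  refine (Lp.eq_zero_iff_ae_eq_zero).2 ?_
  exact (ae_restrict_iff' measurableSet_Ioi).2 h0

/-- Continuous functions with compact support in `(0, ∞)` are total in `L²(ℝ₊)`. -/
lemma eq_top_of_forall_test_mem {K : Submodule ℂ L2Pos} (hK : IsClosed (K : Set L2Pos))
    (h : ∀ φ : ℝ → ℂ, Continuous φ → HasCompactSupport φ → tsupport φ ⊆ Ioi 0 →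
      ∀ f : L2Pos, f =ᵐ[halfLine] φ → f ∈ K) : K = ⊤ := by
  have : CompleteSpace K := hK.completeSpace_coe
  rw [← Submodule.orthogonal_eq_bot_iff, eq_bot_iff]
  intro g hg
  refine eq_zero_of_forall_integral_eq_zero fun ψ hψ hc hs => ?_
  have hcont : Continuous fun s => (ψ s : ℂ) := by fun_prop
  have hsupp : Function.support (fun s => (ψ s : ℂ)) = Function.support ψ := by
    ext s; simp
  have hts : tsupport (fun s => (ψ s : ℂ)) = tsupport ψ := by rw [tsupport, hsupp, tsupport]
  have hcs : HasCompactSupport fun s => (ψ s : ℂ) := by rwa [HasCompactSupport, hts]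
  have hm : MemLp (fun s => (ψ s : ℂ)) 2 halfLine := hcont.memLp_of_hasCompactSupport hcs
  have hin := hg _ (h _ hcont hcs (by rwa [hts]) (hm.toLp _) hm.coeFn_toLp)
  rw [L2.inner_def] at hin
  rw [← hin]
  refine integral_congr_ae ?_
  filter_upwards [hm.coeFn_toLp] with s hs
  rw [hs, RCLike.inner_apply, Complex.conj_ofReal, mul_comm]

end TestFunctions

/-! ### Injectivity of the Laplace transform -/

section Injective

/-- Upgrades almost-everywhere vanishing of the transform to vanishing at every `t > 0`, so that it
can be evaluated at integers. -/
lemma continuousOn_laplaceFun (g : L2Pos) : ContinuousOn (laplaceFun g) (Ioi 0) := by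
  intro t₀ ht₀
  have ht₀ : 0 < t₀ := ht₀
  refine ContinuousAt.continuousWithinAt ?_
  have hm := measurable_coeFn g
  refine continuousAt_of_dominated (bound := fun s => ‖(Real.exp (-(t₀ / 2 * s)) : ℂ) * g s‖)
    (Eventually.of_forall fun t => Measurable.aestronglyMeasurable (by fun_prop)) ?_
    (integrable_exp_mul g (half_pos ht₀)).norm (Eventually.of_forall fun s => by fun_prop)
  filter_upwards [lt_mem_nhds (half_lt_self ht₀)] with t ht
  filter_upwards [ae_restrict_mem measurableSet_Ioi] with s hs
  rw [norm_mul, norm_mul, Complex.norm_real, Complex.norm_real,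
    Real.norm_of_nonneg (Real.exp_pos _).le, Real.norm_of_nonneg (Real.exp_pos _).le]
  refine mul_le_mul_of_nonneg_right (Real.exp_le_exp.2 ?_) (norm_nonneg _)
  exact neg_le_neg (mul_le_mul_of_nonneg_right ht.le (le_of_lt hs))

lemma laplaceFun_eq_zero {g : L2Pos} (hg : laplace g = 0) {t : ℝ} (ht : 0 < t) :
    laplaceFun g t = 0 := by
  have h : laplaceFun g =ᵐ[halfLine] fun _ => 0 :=
    (laplace_apply g).symm.trans ((Lp.eq_zero_iff_ae_eq_zero).1 hg)
  exact Measure.eqOn_open_of_ae_eq h isOpen_Ioi (continuousOn_laplaceFun g) continuousOn_const ht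

/-- By linearity this is vanishing of the transform at the points `n + 1`. The extra factor
`exp(-s)` avoids `t = 0`, where `g` itself need not be integrable. -/
lemma integral_polynomial_exp_eq_zero {g : L2Pos} (hg : laplace g = 0) (p : Polynomial ℝ) :
    Integrable (fun s => ((p.eval (Real.exp (-s)) * Real.exp (-s) : ℝ) : ℂ) * g s) halfLine ∧
      ∫ s in Ioi (0 : ℝ), ((p.eval (Real.exp (-s)) * Real.exp (-s) : ℝ) : ℂ) * g s = 0 := by
  induction p using Polynomial.induction_on' with
  | add p q hp hq =>
    simp only [Polynomial.eval_add, add_mul, Complex.ofReal_add]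
    exact ⟨hp.1.add hq.1, by rw [integral_add hp.1 hq.1, hp.2, hq.2, add_zero]⟩
  | monomial n a =>
    have hn : (0 : ℝ) < n + 1 := by positivity
    have he : ∀ s : ℝ, ((((Polynomial.monomial n a).eval (Real.exp (-s)) * Real.exp (-s) : ℝ) : ℂ) *
        g s) = (a : ℂ) * ((Real.exp (-((n + 1) * s)) : ℂ) * g s) := fun s => by
      have : (Polynomial.monomial n a).eval (Real.exp (-s)) * Real.exp (-s) =
          a * Real.exp (-((n + 1) * s)) := by
        rw [Polynomial.eval_monomial, ← Real.exp_nat_mul, mul_assoc, ← Real.exp_add]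
        congr 2; ring
      rw [this, Complex.ofReal_mul, mul_assoc]
    simp only [he]
    refine ⟨(integrable_exp_mul g hn).const_mul _, ?_⟩
    rw [integral_const_mul]
    have := laplaceFun_eq_zero hg hn
    rw [laplaceFun] at this
    rw [this, mul_zero]

/-- As `x → 0`, `-log x` leaves the compact support. At `x = 0` itself the convention `log 0 = 0`
gives the value `χ 0`, hence the condition `h0`. -/
lemma continuous_comp_neg_log {χ : ℝ → ℝ} (hχ : Continuous χ) (hc : HasCompactSupport χ)
    (h0 : χ 0 = 0) : Continuous fun x => χ (-Real.log x) := by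
  rw [continuous_iff_continuousAt]
  intro x
  rcases eq_or_ne x 0 with rfl | hx
  · have hz : ∀ᶠ y in cocompact ℝ, χ y = 0 := by
      have := hasCompactSupport_iff_eventuallyEq.1 hc
      rwa [coclosedCompact_eq_cocompact] at this
    have hlim : Tendsto (fun x : ℝ => -Real.log x) (nhdsWithin 0 {0}ᶜ) (cocompact ℝ) :=
      (tendsto_neg_atBot_atTop.comp Real.tendsto_log_nhdsNE_zero).mono_right atTop_le_cocompact
    have hev : ∀ᶠ x in nhds (0 : ℝ), χ (-Real.log x) = 0 := by
      filter_upwards [eventually_nhdsWithin_iff.1 (hlim.eventually hz)] with x hx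
      rcases eq_or_ne x 0 with rfl | hx0
      · simpa using h0
      · exact hx hx0
    exact (continuousAt_const (y := (0 : ℝ))).congr (hev.mono fun x hx => hx.symm)
  · exact hχ.continuousAt.comp (Real.continuousAt_log hx).neg

/-- Uniqueness for the Laplace transform on `L²(ℝ₊)`. -/
theorem eq_zero_of_laplace_eq_zero {g : L2Pos} (hg : laplace g = 0) : g = 0 := by
  refine eq_zero_of_forall_integral_eq_zero fun ψ hψ hc hs => ?_
  have hψ0 : ψ 0 = 0 :=
    image_eq_zero_of_notMem_tsupport fun h => lt_irrefl (0 : ℝ) (mem_Ioi.1 (hs h))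
  -- The factor `exp s` compensates the weight `exp(-s)`: after `x = exp(-s)`, Weierstrass
  -- approximation of `χ(-log x)` on `[0, 1]` approximates `ψ` with error at most `ε exp(-s)`.
  set χ : ℝ → ℝ := fun s => ψ s * Real.exp s
  have hφ : Continuous fun x => χ (-Real.log x) :=
    continuous_comp_neg_log (by fun_prop) hc.mul_right (by simp [χ, hψ0])
  have hm := measurable_coeFn g
  have hint : Integrable (fun s => (Real.exp (-(1 * s)) : ℂ) * g s) halfLine :=
    integrable_exp_mul g one_pos
  set C := ∫ s in Ioi (0 : ℝ), ‖(Real.exp (-(1 * s)) : ℂ) * g s‖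
  have hψint : Integrable (fun s => (ψ s : ℂ) * g s) halfLine := by
    have hcs : HasCompactSupport fun s => (ψ s : ℂ) := hc.comp_left Complex.ofReal_zero
    have hcont : Continuous fun s => (ψ s : ℂ) := by fun_prop
    exact MemLp.integrable_mul (p := 2) (q := 2) (hcont.memLp_of_hasCompactSupport hcs) (Lp.memLp g)
  have hbound : ∀ ε > 0, ‖∫ s in Ioi (0 : ℝ), (ψ s : ℂ) * g s‖ ≤ ε * C := by
    intro ε hε
    obtain ⟨p, hp⟩ := exists_polynomial_near_of_continuousOn 0 1 _ hφ.continuousOn ε hε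
    obtain ⟨hpi, hp0⟩ := integral_polynomial_exp_eq_zero hg p
    rw [← sub_zero (∫ s in Ioi (0 : ℝ), (ψ s : ℂ) * g s), ← hp0, ← integral_sub hψint hpi,
      ← integral_const_mul]
    refine norm_integral_le_of_norm_le (hint.norm.const_mul ε) ?_
    filter_upwards [ae_restrict_mem measurableSet_Ioi] with s hs
    have hs : 0 < s := hs
    have h1 := hp (Real.exp (-s)) ⟨(Real.exp_pos _).le, Real.exp_le_one_iff.2 (by linarith)⟩
    simp only [Real.log_exp, neg_neg, χ] at h1
    have h2 : (ψ s : ℂ) * g s - ((p.eval (Real.exp (-s)) * Real.exp (-s) : ℝ) : ℂ) * g s =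
        ((ψ s * Real.exp s - p.eval (Real.exp (-s)) : ℝ) : ℂ) *
          ((Real.exp (-(1 * s)) : ℂ) * g s) := by
      have : ψ s = ψ s * Real.exp s * Real.exp (-(1 * s)) := by
        rw [mul_assoc, ← Real.exp_add]; simp
      conv_lhs => rw [this]
      push_cast
      rw [one_mul]
      ring
    rw [h2, norm_mul, Complex.norm_real, Real.norm_eq_abs, abs_sub_comm]
    exact mul_le_mul_of_nonneg_right h1.le (norm_nonneg _)
  have hC : 0 ≤ C := integral_nonneg fun s => norm_nonneg _
  rw [← norm_le_zero_iff]
  refine le_of_forall_pos_le_add fun δ hδ => ?_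
  -- Dividing by `C + 1` covers the case `C = 0`.
  refine (hbound (δ / (C + 1)) (by positivity)).trans ?_
  rw [zero_add, div_mul_eq_mul_div, div_le_iff₀ (by positivity)]
  nlinarith

end Injective

/-! ### The backward shift and disjointness of the ranges -/

section Shift

lemma measurePreserving_add_one :
    MeasurePreserving (fun t : ℝ => t + 1) halfLine (volume.restrict (Ioi 1)) := by
  have h := (measurePreserving_add_right (volume : Measure ℝ) 1).restrict_preimage
    (measurableSet_Ioi (a := (1 : ℝ)))
  have hpre : (fun t : ℝ => t + 1) ⁻¹' Ioi 1 = Ioi 0 := by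
    ext t; simp
  rwa [hpre] at h

lemma restrict_Ioi_one_le : (volume.restrict (Ioi (1 : ℝ))) ≤ halfLine :=
  Measure.restrict_mono (Ioi_subset_Ioi zero_le_one) le_rfl

lemma ae_add_one {p : ℝ → Prop} (h : ∀ᵐ t ∂halfLine, p t) : ∀ᵐ t ∂halfLine, p (t + 1) :=
  measurePreserving_add_one.quasiMeasurePreserving.ae
    (restrict_Ioi_one_le.absolutelyContinuous.ae_le h)

lemma eLpNorm_shift_le (f : L2Pos) :
    eLpNorm (fun t => f (t + 1)) 2 halfLine ≤ eLpNorm f 2 halfLine := by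
  have := eLpNorm_comp_measurePreserving (p := 2)
    ((measurable_coeFn f).aestronglyMeasurable) measurePreserving_add_one
  exact this.le.trans (eLpNorm_mono_measure _ restrict_Ioi_one_le)

lemma memLp_shift (f : L2Pos) : MemLp (fun t => f (t + 1)) 2 halfLine := by
  have hm := measurable_coeFn f
  exact ⟨Measurable.aestronglyMeasurable (by fun_prop),
    (eLpNorm_shift_le f).trans_lt (Lp.eLpNorm_lt_top f)⟩

/-- The backward unit shift `f ↦ f(· + 1)` on `L²(ℝ₊)`. -/
def shift : L2Pos →L[ℂ] L2Pos :=
  LinearMap.mkContinuous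
    { toFun := fun f => (memLp_shift f).toLp _
      map_add' := fun f g => by
        rw [← MemLp.toLp_add]
        refine MemLp.toLp_congr _ _ ?_
        filter_upwards [ae_add_one (Lp.coeFn_add f g)] with t ht
        rw [ht]
        rfl
      map_smul' := fun c f => by
        rw [RingHom.id_apply, ← MemLp.toLp_const_smul]
        refine MemLp.toLp_congr _ _ ?_
        filter_upwards [ae_add_one (Lp.coeFn_smul c f)] with t ht
        rw [ht]
        rfl }
    1
    (fun f => by
      rw [LinearMap.coe_mk, AddHom.coe_mk, Lp.norm_toLp, Lp.norm_def, one_mul]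
      exact ENNReal.toReal_mono (Lp.eLpNorm_lt_top f).ne (eLpNorm_shift_le f))

lemma shift_apply (f : L2Pos) : shift f =ᵐ[halfLine] fun t => f (t + 1) :=
  MemLp.coeFn_toLp (memLp_shift f)

/-- The range of a finite-rank Hankel operator is invariant under the backward shift. -/
lemma shift_mem_range {V : L2Pos →L[ℂ] L2Pos} (hHankel : IsHankel V) (hrank : HasFiniteRank V)
    {u : L2Pos} (hu : u ∈ LinearMap.range (V : L2Pos →ₗ[ℂ] L2Pos)) :
    shift u ∈ LinearMap.range (V : L2Pos →ₗ[ℂ] L2Pos) := by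
  obtain ⟨h, -, hh⟩ := hHankel
  have : FiniteDimensional ℂ (LinearMap.range (V : L2Pos →ₗ[ℂ] L2Pos)) := hrank
  have hcl := Submodule.closed_of_finiteDimensional (LinearMap.range (V : L2Pos →ₗ[ℂ] L2Pos))
  -- The range is closed, so its preimage under `shift ∘L V` is everything once it contains the test
  -- functions.
  have htop : (LinearMap.range (V : L2Pos →ₗ[ℂ] L2Pos)).comap
      ((shift ∘L V : L2Pos →L[ℂ] L2Pos) : L2Pos →ₗ[ℂ] L2Pos) = ⊤ := by
    refine eq_top_of_forall_test_mem (hcl.preimage (shift ∘L V).continuous) ?_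
    intro φ hφ hc hs f hf
    -- The Hankel structure enters here: shifting `V φ` backward equals applying `V` to `φ(· - 1)`,
    -- which is still supported in `(0, ∞)`.
    have hφ' : Continuous (φ ∘ Homeomorph.subRight (1 : ℝ)) := hφ.comp (Homeomorph.continuous _)
    have hc' : HasCompactSupport (φ ∘ Homeomorph.subRight (1 : ℝ)) := hc.comp_homeomorph _
    have hs' : tsupport (φ ∘ Homeomorph.subRight (1 : ℝ)) ⊆ Ioi 0 := by
      rw [tsupport_comp_eq_preimage]
      intro s hs1
      have : 0 < s - 1 := hs hs1
      exact lt_trans zero_lt_one (sub_pos.1 this)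
    have hm : MemLp (φ ∘ Homeomorph.subRight (1 : ℝ)) 2 halfLine :=
      hφ'.memLp_of_hasCompactSupport hc'
    refine ⟨hm.toLp _, ?_⟩
    refine Lp.ext ?_
    have h1 := hh _ hφ' hc' hs' _ hm.coeFn_toLp
    have h2 := ae_add_one (hh φ hφ hc hs f hf)
    refine EventuallyEq.trans h1 (EventuallyEq.trans ?_ (shift_apply (V f)).symm)
    filter_upwards [h2] with t ht
    -- Both integrals are extended to the whole line, where Lebesgue measure is translation
    -- invariant.
    rw [ht, setIntegral_eq_integral_of_tsupport_subset hs' fun s => h (t + s),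
      setIntegral_eq_integral_of_tsupport_subset hs fun s => h (t + 1 + s),
      ← integral_add_right_eq_self _ (1 : ℝ)]
    refine integral_congr_ae (Eventually.of_forall fun s => ?_)
    simp [add_comm, add_left_comm]
  obtain ⟨f, rfl⟩ := hu
  exact (htop.symm ▸ Submodule.mem_top : f ∈ _)

lemma memLp_exp_neg_mul_coeFn (g : L2Pos) :
    MemLp (fun s => (Real.exp (-s) : ℂ) * g s) 2 halfLine := by
  have hm := measurable_coeFn g
  refine (Lp.memLp g).of_le (Measurable.aestronglyMeasurable (by fun_prop)) ?_
  filter_upwards [ae_restrict_mem measurableSet_Ioi] with s hs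
  have hs : 0 < s := hs
  rw [norm_mul, Complex.norm_real, Real.norm_of_nonneg (Real.exp_pos _).le]
  exact mul_le_of_le_one_left (norm_nonneg _) (Real.exp_le_one_iff.2 (by linarith))

/-- The backward shift of a Laplace transform `ℒ g` is the Laplace transform of `e⁻ˢ g(s)`. -/
lemma shift_laplace (g : L2Pos) :
    shift (laplace g) = laplace ((memLp_exp_neg_mul_coeFn g).toLp _) := by
  refine Lp.ext ?_
  refine (shift_apply _).trans ?_
  filter_upwards [ae_add_one (laplace_apply g),
    laplace_apply ((memLp_exp_neg_mul_coeFn g).toLp _)] with t h1 h2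
  rw [h1, h2, laplaceFun, laplaceFun]
  refine integral_congr_ae ?_
  filter_upwards [(memLp_exp_neg_mul_coeFn g).coeFn_toLp] with s hs
  rw [hs, ← mul_assoc, ← Complex.ofReal_mul, ← Real.exp_add]
  congr 4; ring

/-- No nonzero Laplace transform is an eigenvector of the backward shift. -/
lemma eq_zero_of_shift_laplace_eq_smul {g : L2Pos} {c : ℂ}
    (h : shift (laplace g) = c • laplace g) : g = 0 := by
  rw [shift_laplace, ← map_smul, ← sub_eq_zero, ← map_sub] at h
  have h0 := sub_eq_zero.1 (eq_zero_of_laplace_eq_zero h)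
  refine (Lp.eq_zero_iff_ae_eq_zero).2 ?_
  -- By injectivity of the real exponential, `exp(-s) = c` holds for at most one `s`.
  have hne : ∀ᵐ s ∂halfLine, (Real.exp (-s) : ℂ) ≠ c := by
    have hsub : {s : ℝ | (Real.exp (-s) : ℂ) = c}.Subsingleton := fun s hs t ht => by
      have : (Real.exp (-s) : ℂ) = Real.exp (-t) := hs.trans ht.symm
      exact neg_injective (Real.exp_injective (Complex.ofReal_injective this))
    exact measure_eq_zero_iff_ae_notMem.1 (hsub.measure_zero _)
  have h1 := (memLp_exp_neg_mul_coeFn g).coeFn_toLp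
  rw [h0] at h1
  filter_upwards [h1, Lp.coeFn_smul c g, hne] with s hs1 hs2 hs3
  rw [hs2, Pi.smul_apply, smul_eq_mul] at hs1
  exact (mul_eq_mul_right_iff.1 hs1).resolve_left (Ne.symm hs3)

/-- A finite-rank Hankel operator and the Laplace transform have ranges meeting only in zero. -/
theorem disjoint_range_laplace {V : L2Pos →L[ℂ] L2Pos} (hHankel : IsHankel V)
    (hrank : HasFiniteRank V) :
    Disjoint (LinearMap.range (V : L2Pos →ₗ[ℂ] L2Pos))
      (LinearMap.range (laplace : L2Pos →ₗ[ℂ] L2Pos)) := by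
  have : FiniteDimensional ℂ (LinearMap.range (V : L2Pos →ₗ[ℂ] L2Pos)) := hrank
  set M := LinearMap.range (V : L2Pos →ₗ[ℂ] L2Pos) ⊓ LinearMap.range (laplace : L2Pos →ₗ[ℂ] L2Pos)
  have hfin : FiniteDimensional ℂ M := Submodule.finiteDimensional_inf_left _ _
  rw [disjoint_iff]
  by_contra hM
  have : Nontrivial M := Submodule.nontrivial_iff_ne_bot.2 hM
  have hinv : ∀ u ∈ M, (shift : L2Pos →ₗ[ℂ] L2Pos) u ∈ M := by
    rintro u ⟨hu1, g, rfl⟩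
    exact ⟨shift_mem_range hHankel hrank hu1, _, (shift_laplace g).symm⟩
  -- A nonzero finite-dimensional complex space invariant under the shift contains an eigenvector of
  -- it.
  obtain ⟨c, hc⟩ := Module.End.exists_eigenvalue ((shift : L2Pos →ₗ[ℂ] L2Pos).restrict hinv)
  obtain ⟨⟨u, hu⟩, hv⟩ := hc.exists_hasEigenvector
  obtain ⟨-, g, rfl⟩ := id hu
  have heq : shift (laplace g) = c • laplace g := congrArg Subtype.val hv.apply_eq_smul
  have hg := eq_zero_of_shift_laplace_eq_smul heq
  refine hv.2 (Subtype.ext ?_)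
  simp [hg]

end Shift

end FiniteRankHankel

end

/-! ### The main theorem -/

theorem theorem1p3
    (V : FiniteRankHankel.L2Pos →L[ℂ] FiniteRankHankel.L2Pos)
    (hHankel : FiniteRankHankel.IsHankel V)
    (hrank : FiniteRankHankel.HasFiniteRank V)
    (hV : IsSelfAdjoint V) :
    FiniteRankHankel.negativeMultiplicity (FiniteRankHankel.carleman + V) =
        FiniteRankHankel.negativeMultiplicity V ∧
      ((FiniteRankHankel.carleman + V).IsPositive ↔ V.IsPositive) := by
  have : FiniteDimensional ℂ (LinearMap.range
    (V : FiniteRankHankel.L2Pos →ₗ[ℂ] FiniteRankHankel.L2Pos)) := hrank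
  have hmult : FiniteRankHankel.negativeMultiplicity (FiniteRankHankel.carleman + V) =
      FiniteRankHankel.negativeMultiplicity V := by
    refine le_antisymm
      (FiniteRankHankel.negativeMultiplicity_add_le FiniteRankHankel.carleman_isPositive hV) ?_
    rw [FiniteRankHankel.carleman_eq_laplace_mul_laplace]
    exact FiniteRankHankel.negativeMultiplicity_le_add hV FiniteRankHankel.laplace_isSelfAdjoint
      (FiniteRankHankel.disjoint_range_laplace hHankel hrank)
  refine ⟨hmult, ?_⟩
  rw [FiniteRankHankel.isPositive_iff_negativeMultiplicity_eq_zero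
      (FiniteRankHankel.carleman_isSelfAdjoint.add hV),
    FiniteRankHankel.isPositive_iff_negativeMultiplicity_eq_zero hV, hmult]
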